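/- Let $\mathbb{F}_q$ be the finite field with $q$ elements, let $1<s<r$, $s<d$ and $q^s>d$, and let $1<h\le r-s+1$. Let $\mathcal{F}_d$ be the set of polynomials in $\mathbb{F}_q[X_1,\dots,X_r]$ of total degree at most $d$; the statement holds both when the zero polynomial is admitted in $\mathcal{F}_d$ and when it is excluded. For a system $\boldsymbol F=(F_1,\dots,F_s)\in\mathcal{F}_d^s$ and $\boldsymbol a\in\mathbb{F}_q^{r-s}$, let $\boldsymbol F(\boldsymbol a,-)$ be the system of $s$ polynomials in $\mathbb{F}_q[X_{r-s+1},\dots,X_r]$ obtained by substituting $\boldsymbol a$ for $(X_1,\dots,X_{r-s})$, and let $Z(\boldsymbol F(\boldsymbol a,-))$ be its number of common zeros in $\mathbb{F}_q^s$. Let $\mathbb{F}_h$ be the set of $h$-tuples $(\boldsymbol a_1,\dots,\boldsymbol a_h)$ of pairwise distinct elements of $\mathbb{F}_q^{r-s}$, endow the finite set $\mathbb{F}_h\times\mathcal{F}_d^s$ with the uniform probability $P_h$, and define on it the random variable $$C_h\big((\boldsymbol a_1,\dots,\boldsymbol a_h),\boldsymbol F\big):=\min\{j\in\{1,\dots,h\}: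 Z(\boldsymbol F(\boldsymbol a_j,-))>0\},$$ with the value $\infty$ if there is no such $j$. For $m\ge 1$ put $$s_m:=\sum_{j=1}^m(-1)^{j-1}\binom{q^s}{j}q^{-sj},\qquad s_m^+:=\sum_{j=1}^m\binom{q^s}{j}q^{-sj},\qquad t_m:=\binom{q^s}{m}q^{-sm}.$$ Then $$\big|P_h[C_h=h]-s_d(1-s_d)^{h-1}\big|\le t_{d+1}\Big((1+s_{d+1}^+)^{h-1}+\tfrac12\Big)+\tfrac2q\quad\text{for } d \text{ odd},$$ $$\big|P_h[C_h=h]-s_{d+1}(1-s_{d+1})^{h-1}\big|\le t_{d+1}\Big((1+s_{d+1}^+)^{h-1}+\tfrac12\Big)+\tfrac2q\quad\text{for } d \text{ even}.$$ -/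

import Mathlib

/-- The polynomials in `K[X_1, …, X_r]` of total degree at most `d` (including `0`). -/
def polysDegLE (K : Type*) [Field K] (r d : ℕ) : Set (MvPolynomial (Fin r) K) :=
  {F | F.totalDegree ≤ d}

/-- The partial specialization `F(a, -)`: the first `r - s` variables of `F` are replaced by the
coordinates of `a`, and the last `s` variables are kept (and renumbered from `0` to `s - 1`). -/
noncomputable def specialize {K : Type*} [Field K] {r s : ℕ} (a : Fin (r - s) → K)
    (F : MvPolynomial (Fin r) K) : MvPolynomial (Fin s) K :=
  MvPolynomial.aeval (fun i : Fin r =>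
    if hi : (i : ℕ) < r - s then MvPolynomial.C (a ⟨i, hi⟩)
    else MvPolynomial.X ⟨(i : ℕ) - (r - s), by omega⟩) F

/-- The point `(a, x)` of `K^r`. -/
def stripPoint {K : Type*} {r s : ℕ} (a : Fin (r - s) → K) (x : Fin s → K) : Fin r → K :=
  fun i => if hi : (i : ℕ) < r - s then a ⟨i, hi⟩ else x ⟨(i : ℕ) - (r - s), by omega⟩

theorem eval_specialize {K : Type*} [Field K] {r s : ℕ} (a : Fin (r - s) → K) (x : Fin s → K)
    (F : MvPolynomial (Fin r) K) :
    MvPolynomial.eval x (specialize a F) = MvPolynomial.eval (stripPoint a x) F := by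
  have h : (MvPolynomial.aeval x).comp (MvPolynomial.aeval (fun i : Fin r =>
      if hi : (i : ℕ) < r - s then MvPolynomial.C (a ⟨i, hi⟩)
      else MvPolynomial.X ⟨(i : ℕ) - (r - s), by omega⟩)) =
      (MvPolynomial.aeval (stripPoint a x) : MvPolynomial (Fin r) K →ₐ[K] K) := by
    ext i
    by_cases hi : (i : ℕ) < r - s <;> simp [stripPoint, hi]
  have := DFunLike.congr_fun h F
  simpa [specialize, MvPolynomial.aeval_eq_eval] using this

/-- The number `Z(G)` of common zeros in `K^s` of a system `G` of `s` polynomials in `s`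
variables. -/
noncomputable def numZeros {K : Type*} [Field K] {s : ℕ}
    (G : Fin s → MvPolynomial (Fin s) K) : ℕ :=
  {x : Fin s → K | ∀ j, MvPolynomial.eval x (G j) = 0}.ncard

/-- The sample space: ordered `h`-tuples of pairwise distinct `a_1, …, a_h` in `K^(r-s)`, together
with a system of `s` polynomials from the family `Fam`. -/
abbrev SearchSpace {K : Type*} [Field K] {r : ℕ} (Fam : Set (MvPolynomial (Fin r) K))
    (s h : ℕ) : Type _ :=
  (Fin h ↪ (Fin (r - s) → K)) × (Fin s → Fam)

/-- The random variable `C_h`: the least `j` in `{1, …, h}` such that the system specialized at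
`a_j` has a zero in `K^s`, and `∞` if there is none (the infimum of the empty family is `⊤`).
The index `j : Fin h` stands for `a_{j+1}`. -/
noncomputable def stripsNeeded {K : Type*} [Field K] {r : ℕ}
    {Fam : Set (MvPolynomial (Fin r) K)} {s h : ℕ} (w : SearchSpace Fam s h) : ℕ∞ :=
  ⨅ (j : Fin h) (_ : 0 < numZeros (fun i => specialize (w.1 j) (w.2 i).1)), (((j : ℕ) + 1 : ℕ) : ℕ∞)

/-- The probability `P_h[C_h = h]` for the uniform distribution on the (finite) sample space. -/
noncomputable def probStripsNeeded {K : Type*} [Field K] {r : ℕ}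
    (Fam : Set (MvPolynomial (Fin r) K)) (s h : ℕ) : ℝ :=
  ({w : SearchSpace Fam s h | stripsNeeded w = (h : ℕ∞)}.ncard : ℝ) /
    (Nat.card (SearchSpace Fam s h) : ℝ)

/-- `t_m = binom(q^s, m) q^(-s m)`. -/
noncomputable def tTerm (q s m : ℕ) : ℝ := ((q ^ s).choose m : ℝ) / (q : ℝ) ^ (s * m)

/-- `s_m = ∑_{j=1}^m (-1)^(j-1) binom(q^s, j) q^(-s j)`. -/
noncomputable def sAlt (q s m : ℕ) : ℝ := ∑ j ∈ Finset.Icc 1 m, (-1 : ℝ) ^ (j - 1) * tTerm q s j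

/-- `s_m^+ = ∑_{j=1}^m binom(q^s, j) q^(-s j)`. -/
noncomputable def sPlus (q s m : ℕ) : ℝ := ∑ j ∈ Finset.Icc 1 m, tTerm q s j

/-! Fix the strips `a_1, …, a_h` and let `Z_i` be the number of zeros of a random system in the i-th
strip. The event `C_h = h` says `Z_i = 0` for `i < h` and `Z_h > 0`. Bonferroni's inequalities
replace each indicator by an alternating sum of `binom(Z_i, j)`, `j ≤ d`, with error at most
`binom(Z_i, d + 1)`. The expectation of a product of such binomials is a sum over finite sets `T_i`
of the probability that the system vanishes on all `{a_i} × T_i`, so the expectation factors as soon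
as the values at these points are independent and uniform.

For affinely independent `a_i` this independence holds when every `T_i` has at most `d` points,
except that one may have `d + 1`: polynomials `g₀(x) + ∑ l_i(a) g_i(x)`, with `l_i` affine
separating the strips, interpolate arbitrary values (`exists_interpolating_on_strips`). Telescoping
the product of indicators puts only one remainder into each error term, which matches this
constraint exactly, and gives `abs_card_sub_le_of_indep`: main term `s_d (1 - s_d)^(h-1)`, error
`t_{d+1} (1 + s_d^+)^(h-1)`.

Affinely dependent tuples have proportion at most `1/(q-1) ≤ 2/q`, by double counting of linear
relations (`card_not_affineIndependent_mul_le`). The remaining `t_{d+1}/2` pays for two things: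
excluding the zero polynomial, which costs at most `s/#F_d`, and, for even `d`, passing from `s_d`
to `s_{d+1} = s_d + t_{d+1}` through a Lipschitz bound on `x (1 - x)^m`. -/

/-! ### Bonferroni inequalities and products of independent inclusion events -/

/-- A weighted sum of binomial coefficients of `#Z` as a sum over subsets of the ambient type. -/
theorem sum_mul_choose_card_eq {X : Type*} [Fintype X] [DecidableEq X] (S : Finset ℕ)
    (u : ℕ → ℝ) (Z : Finset X) :
    ∑ j ∈ S, u j * ((Z.card.choose j : ℕ) : ℝ) =
      ∑ T : Finset X with T.card ∈ S, u T.card * (if T ⊆ Z then 1 else 0) := by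
  have h1 : ∀ j ∈ S, u j * ((Z.card.choose j : ℕ) : ℝ) =
      ∑ T ∈ (Finset.univ.filter fun T : Finset X => T.card ∈ S) with T.card = j,
        u T.card * (if T ⊆ Z then 1 else 0) := by
    intro j hj
    rw [← Finset.card_powersetCard, Finset.card_eq_sum_ones, Nat.cast_sum, Finset.mul_sum]
    symm
    simp only [mul_ite, mul_one, mul_zero, ← Finset.sum_filter]
    refine Finset.sum_congr ?_ ?_
    · ext T
      simp only [Finset.mem_filter, Finset.mem_univ, true_and, Finset.mem_powersetCard]
      constructor
      · rintro ⟨⟨_, h⟩, h'⟩; exact ⟨h', h⟩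
      · rintro ⟨h', h⟩; exact ⟨⟨h ▸ hj, h⟩, h'⟩
    · intro T hT
      simp only [Finset.mem_powersetCard] at hT
      simp [hT.2]
  rw [Finset.sum_congr rfl h1]
  exact Finset.sum_fiberwise_of_maps_to (fun T hT => (Finset.mem_filter.1 hT).2) _

/-- Expectation of a product of binomial sums when the inclusion events are independent. -/
theorem sum_prod_sum_mul_choose {ι Ω X : Type*} [Fintype ι] [DecidableEq ι] [Fintype Ω]
    [Fintype X] [DecidableEq X] (Z : ι → Ω → Finset X) (N ρ : ℝ) (S : ι → Finset ℕ)
    (u : ι → ℕ → ℝ)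
    (hind : ∀ T : ι → Finset X, (∀ i, (T i).card ∈ S i) →
      ((Finset.univ.filter fun ω => ∀ i, T i ⊆ Z i ω).card : ℝ) = N * ∏ i, ρ ^ (T i).card) :
    ∑ ω, ∏ i, ∑ j ∈ S i, u i j * (((Z i ω).card.choose j : ℕ) : ℝ) =
      N * ∏ i, ∑ j ∈ S i, u i j * (((Fintype.card X).choose j : ℕ) * ρ ^ j) := by
  have hR : ∀ i, ∑ j ∈ S i, u i j * (((Fintype.card X).choose j : ℕ) * ρ ^ j) =
      ∑ T : Finset X with T.card ∈ S i, u i T.card * ρ ^ T.card := by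
    intro i
    have := sum_mul_choose_card_eq (S i) (fun j => u i j * ρ ^ j) (Finset.univ : Finset X)
    simp only [Finset.subset_univ, if_true, mul_one, Finset.card_univ] at this
    rw [← this]
    exact Finset.sum_congr rfl fun j _ => by ring
  simp_rw [sum_mul_choose_card_eq, hR, Finset.prod_univ_sum, Finset.mul_sum]
  rw [Finset.sum_comm]
  refine Finset.sum_congr rfl fun T hT => ?_
  simp only [Fintype.mem_piFinset, Finset.mem_filter, Finset.mem_univ, true_and] at hT
  simp_rw [Finset.prod_mul_distrib, ← Finset.mul_sum, Finset.prod_boole]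
  simp only [Finset.mem_univ, true_imp_iff]
  rw [Finset.sum_boole, hind T hT]
  ring

theorem sum_range_neg_one_pow_choose_succ (n d : ℕ) :
    ∑ j ∈ Finset.range (d + 1), (-1 : ℝ) ^ j * (((n + 1).choose j : ℕ) : ℝ) =
      (-1) ^ d * ((n.choose d : ℕ) : ℝ) := by
  have := @Int.alternating_sum_range_choose_eq_choose n d
  exact_mod_cast this

/-- Bonferroni bound for the indicator of `Z = 0`. -/
theorem abs_indicator_eq_zero_sub_le (Z d : ℕ) :
    |(if Z = 0 then (1 : ℝ) else 0) -
      ∑ j ∈ Finset.range (d + 1), (-1 : ℝ) ^ j * ((Z.choose j : ℕ) : ℝ)| ≤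
      ((Z.choose (d + 1) : ℕ) : ℝ) := by
  cases Z with
  | zero =>
    rw [Finset.sum_range_succ']
    simp
  | succ n =>
    -- For `Z = n + 1` the truncated sum is `± binom(n, d)`, and Pascal's rule bounds this by
    -- `binom(n + 1, d + 1)`.
    rw [sum_range_neg_one_pow_choose_succ]
    simp only [Nat.succ_ne_zero, if_false, zero_sub, abs_neg, abs_mul, abs_pow, abs_one, one_pow,
      one_mul, Nat.abs_cast, Nat.choose_succ_succ]
    push_cast
    linarith [Nat.cast_nonneg (α := ℝ) (n.choose (d + 1))]

theorem sum_range_neg_one_pow_eq_one_sub (d : ℕ) (τ : ℕ → ℝ) (h0 : τ 0 = 1) :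
    ∑ j ∈ Finset.range (d + 1), (-1 : ℝ) ^ j * τ j =
      1 - ∑ j ∈ Finset.Icc 1 d, (-1 : ℝ) ^ (j - 1) * τ j := by
  rw [Finset.range_eq_Ico, Finset.sum_eq_sum_Ico_succ_bot (by omega)]
  have : Finset.Ico (0 + 1) (d + 1) = Finset.Icc 1 d := by ext; simp
  rw [this, h0, sub_eq_add_neg, ← Finset.sum_neg_distrib]
  congr 1
  · simp
  · refine Finset.sum_congr rfl fun j hj => ?_
    obtain ⟨k, rfl⟩ : ∃ k, j = k + 1 := ⟨j - 1, by simp at hj; omega⟩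
    simp [pow_succ]

theorem sum_range_eq_one_add (d : ℕ) (τ : ℕ → ℝ) (h0 : τ 0 = 1) :
    ∑ j ∈ Finset.range (d + 1), τ j = 1 + ∑ j ∈ Finset.Icc 1 d, τ j := by
  rw [Finset.range_eq_Ico, Finset.sum_eq_sum_Ico_succ_bot (by omega)]
  have : Finset.Ico (0 + 1) (d + 1) = Finset.Icc 1 d := by ext; simp
  rw [this, h0]

/-- Bonferroni bound for the indicator of `Z ≠ 0`. -/
theorem abs_indicator_ne_zero_sub_le (Z d : ℕ) :
    |(if Z = 0 then (0 : ℝ) else 1) -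
      ∑ j ∈ Finset.Icc 1 d, (-1 : ℝ) ^ (j - 1) * ((Z.choose j : ℕ) : ℝ)| ≤
      ((Z.choose (d + 1) : ℕ) : ℝ) := by
  have h := abs_indicator_eq_zero_sub_le Z d
  rw [sum_range_neg_one_pow_eq_one_sub d (fun j => ((Z.choose j : ℕ) : ℝ)) (by simp)] at h
  rw [← abs_neg]
  convert h using 2
  split_ifs <;> ring

theorem abs_sum_mul_le_sum (S : Finset ℕ) (u τ : ℕ → ℝ) (hu : ∀ j, |u j| = 1)
    (hτ : ∀ j, 0 ≤ τ j) : |∑ j ∈ S, u j * τ j| ≤ ∑ j ∈ S, τ j := by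
  refine (Finset.abs_sum_le_sum_abs _ _).trans (Finset.sum_le_sum fun j _ => ?_)
  rw [abs_mul, hu, one_mul, abs_of_nonneg (hτ j)]

/-- Telescoping: the k-th term has exact factors `α` before `k`, the difference at `k`, and
approximations `β` after it. Bounding the exact factors by 1 leaves a single remainder `R k` per
term. -/
theorem abs_prod_sub_prod_le_sum {n : ℕ} (α β R M : Fin n → ℝ) (hα0 : ∀ i, 0 ≤ α i)
    (hα1 : ∀ i, α i ≤ 1) (hR : ∀ i, |α i - β i| ≤ R i) (hM : ∀ i, |β i| ≤ M i) :
    |∏ i, α i - ∏ i, β i| ≤ ∑ k, ∏ i, (if i < k then 1 else if i = k then R i else M i) := by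
  have h := Finset.prod_add_ordered Finset.univ β (fun i => α i - β i)
  simp only [add_sub_cancel] at h
  rw [h, add_sub_cancel_left]
  refine (Finset.abs_sum_le_sum_abs _ _).trans (Finset.sum_le_sum fun k _ => ?_)
  have h3 : ∏ i, (if i < k then 1 else if i = k then R i else M i) =
      R k * ∏ i with k < i, M i := by
    rw [← Finset.mul_prod_erase Finset.univ _ (Finset.mem_univ k)]
    simp only [lt_irrefl, if_false, if_true]
    congr 1
    rw [Finset.prod_filter]
    rw [← Finset.mul_prod_erase Finset.univ (fun i => if k < i then M i else 1)
      (Finset.mem_univ k)]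
    simp only [lt_irrefl, if_false, one_mul]
    refine Finset.prod_congr rfl fun i hi => ?_
    have hik : i ≠ k := Finset.ne_of_mem_erase hi
    rcases lt_or_gt_of_ne hik with h | h
    · simp [h, h.le.not_gt]
    · simp [h, h.le.not_gt, hik]
  rw [h3, abs_mul, abs_mul, Finset.abs_prod, Finset.abs_prod]
  have hR0 : 0 ≤ R k := (abs_nonneg _).trans (hR k)
  refine mul_le_mul ?_ (Finset.prod_le_prod (fun i _ => abs_nonneg _) fun i _ => hM i)
    (Finset.prod_nonneg fun i _ => abs_nonneg _) hR0
  refine (mul_le_of_le_one_right (abs_nonneg _) ?_).trans (hR k)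
  exact Finset.prod_le_one (fun i _ => abs_nonneg _)
    fun i _ => by rw [abs_of_nonneg (hα0 i)]; exact hα1 i

/-- A geometric sum in the form produced by telescoping a product. -/
theorem sum_prod_ite_lt_eq (n : ℕ) (t σ : ℝ) :
    ∑ k : Fin (n + 1), ∏ i : Fin (n + 1),
      (if i < k then 1 else if i = k then t else if i = Fin.last n then σ else 1 + σ) =
      t * (1 + σ) ^ n := by
  induction n with
  | zero => simp
  | succ n ih =>
    rw [Fin.sum_univ_succ]
    simp only [Fin.not_lt_zero, if_false]
    have h1 : ∀ k : Fin (n + 1), ∏ i : Fin (n + 1 + 1),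
        (if i < k.succ then 1 else if i = k.succ then t else
          if i = Fin.last (n + 1) then σ else 1 + σ) =
        ∏ i : Fin (n + 1),
          (if i < k then 1 else if i = k then t else if i = Fin.last n then σ else 1 + σ) := by
      intro k
      rw [Fin.prod_univ_succ, if_pos (Fin.succ_pos k), one_mul]
      simp only [Fin.succ_lt_succ_iff, Fin.succ_inj, ← Fin.succ_last]
    simp_rw [h1, ih]
    rw [Fin.prod_univ_succ, if_pos rfl]
    simp only [Fin.succ_ne_zero, if_false, ← Fin.succ_last, Fin.succ_inj]
    rw [Fin.prod_univ_castSucc]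
    simp only [Fin.castSucc_ne_last, if_false, if_true, Finset.prod_const, Finset.card_univ,
      Fintype.card_fin]
    ring

/-- Truncated inclusion-exclusion for `n + 1` random sets: the first `n` empty, the last one not,
when inclusions of at most `d` points (`d + 1` for one of the sets) are independent. -/
theorem abs_card_sub_le_of_indep {n d : ℕ} {Ω X : Type*} [Fintype Ω]
    [Fintype X] [DecidableEq X] (Z : Fin (n + 1) → Ω → Finset X) (N ρ : ℝ)
    (t : ℕ → ℝ) (ht : ∀ j, t j = ((Fintype.card X).choose j : ℕ) * ρ ^ j)
    (hind : ∀ (T : Fin (n + 1) → Finset X) (k : Fin (n + 1)), (T k).card ≤ d + 1 →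
      (∀ i, i ≠ k → (T i).card ≤ d) →
      ((Finset.univ.filter fun ω => ∀ i, T i ⊆ Z i ω).card : ℝ) = N * ∏ i, ρ ^ (T i).card) :
    |((Finset.univ.filter fun ω => ∀ i, (i = Fin.last n ↔ Z i ω ≠ ∅)).card : ℝ) -
      N * ((∑ j ∈ Finset.Icc 1 d, (-1) ^ (j - 1) * t j) *
        (1 - ∑ j ∈ Finset.Icc 1 d, (-1) ^ (j - 1) * t j) ^ n)| ≤
      N * (t (d + 1) * (1 + ∑ j ∈ Finset.Icc 1 d, t j) ^ n) := by
  classical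
  have ht0 : t 0 = 1 := by simp [ht]
  let S : Fin (n + 1) → Finset ℕ := fun i =>
    if i = Fin.last n then Finset.Icc 1 d else Finset.range (d + 1)
  let u : Fin (n + 1) → ℕ → ℝ := fun i j =>
    if i = Fin.last n then (-1) ^ (j - 1) else (-1) ^ j
  have hS : ∀ i j, j ∈ S i → j ≤ d := by
    intro i j hj
    simp only [S] at hj
    split_ifs at hj <;> simp at hj <;> omega
  let c : Fin (n + 1) → Ω → ℕ → ℝ := fun i ω j => (((Z i ω).card.choose j : ℕ) : ℝ)
  let α : Ω → Fin (n + 1) → ℝ := fun ω i => if (i = Fin.last n ↔ Z i ω ≠ ∅) then 1 else 0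
  let β : Ω → Fin (n + 1) → ℝ := fun ω i => ∑ j ∈ S i, u i j * c i ω j
  have hpt : ∀ ω, |∏ i, α ω i - ∏ i, β ω i| ≤
      ∑ k, ∏ i, (if i < k then 1 else if i = k then c i ω (d + 1) else ∑ j ∈ S i, c i ω j) := by
    intro ω
    refine abs_prod_sub_prod_le_sum _ _ _ _ (fun i => ?_) (fun i => ?_) (fun i => ?_)
      (fun i => ?_)
    · simp only [α]; split_ifs <;> norm_num
    · simp only [α]; split_ifs <;> norm_num
    · by_cases hi : i = Fin.last n
      · have := abs_indicator_ne_zero_sub_le (Z i ω).card d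
        simp only [Finset.card_eq_zero] at this
        simp only [α, β, S, u, c, hi, if_true, true_iff, ite_not]
        subst hi
        exact this
      · have := abs_indicator_eq_zero_sub_le (Z i ω).card d
        simp only [Finset.card_eq_zero] at this
        simp only [α, β, S, u, c, hi, if_false, false_iff, not_not, ne_eq]
        exact this
    · refine abs_sum_mul_le_sum _ _ _ (fun j => ?_) (fun j => Nat.cast_nonneg _)
      simp only [u]; split_ifs <;> simp
  have hα : ((Finset.univ.filter fun ω => ∀ i, (i = Fin.last n ↔ Z i ω ≠ ∅)).card : ℝ) =
      ∑ ω, ∏ i, α ω i := by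
    simp only [α, Finset.prod_boole, Finset.sum_boole, Finset.mem_univ, true_imp_iff]
  have hβ : ∑ ω, ∏ i, β ω i = N * ((∑ j ∈ Finset.Icc 1 d, (-1) ^ (j - 1) * t j) *
        (1 - ∑ j ∈ Finset.Icc 1 d, (-1) ^ (j - 1) * t j) ^ n) := by
    -- All sets have at most `d` points here, so any index can play the exceptional one; `0` is
    -- taken.
    have := sum_prod_sum_mul_choose Z N ρ S u fun T hT => by
      convert hind T 0 ((hS _ _ (hT 0)).trans (Nat.le_succ d)) fun i _ => hS _ _ (hT i)
    simp only [β, c]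
    rw [this]
    simp only [← ht]
    rw [Fin.prod_univ_castSucc]
    simp only [S, u, Fin.castSucc_ne_last, if_false, if_true, Finset.prod_const,
      Finset.card_univ, Fintype.card_fin]
    rw [sum_range_neg_one_pow_eq_one_sub d t ht0]
    ring
  have hrem : ∀ k, ∑ ω, ∏ i, (if i < k then 1 else if i = k then c i ω (d + 1)
      else ∑ j ∈ S i, c i ω j) = N * ∏ i, (if i < k then 1 else if i = k then t (d + 1)
        else if i = Fin.last n then ∑ j ∈ Finset.Icc 1 d, t j
          else 1 + ∑ j ∈ Finset.Icc 1 d, t j) := by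
    intro k
    -- The factor 1 before `k` is written as `binom(Z, 0)`, so the product formula applies again,
    -- with `k` the only index carrying `d + 1` points.
    let S' : Fin (n + 1) → Finset ℕ := fun i => if i < k then {0} else if i = k then {d + 1}
      else S i
    have key := sum_prod_sum_mul_choose Z N ρ S' (fun _ _ => 1) fun T hT => by
      have h := hind T k ?_ fun i hi => ?_
      · convert h
      · have := hT k
        simp only [S', lt_irrefl, if_false, if_true, Finset.mem_singleton] at this
        exact this.le
      · have := hT i
        simp only [S', hi, if_false] at this
        split_ifs at this
        · simp at this; simp [this]
        · exact hS _ _ this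
    simp only [one_mul, ← ht] at key
    convert key using 3 with ω _ i _ i
    · simp only [S', c]
      split_ifs <;> simp
    · simp only [S', S]
      split_ifs
      · simp [ht0]
      · simp
      · rfl
      · rw [sum_range_eq_one_add d t ht0]
  rw [hα, ← hβ, ← Finset.sum_sub_distrib]
  refine (Finset.abs_sum_le_sum_abs _ _).trans ((Finset.sum_le_sum fun ω _ => hpt ω).trans ?_)
  rw [Finset.sum_comm, Finset.sum_congr rfl fun k _ => hrem k, ← Finset.mul_sum,
    sum_prod_ite_lt_eq]

/-! ### Numerical bounds for `t_m` and `s_m` -/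

theorem tTerm_eq (q s m : ℕ) :
    tTerm q s m = ((q ^ s).choose m : ℝ) * (((q : ℝ) ^ s)⁻¹) ^ m := by
  rw [tTerm, div_eq_mul_inv, pow_mul, inv_pow]

theorem tTerm_nonneg (q s m : ℕ) : 0 ≤ tTerm q s m := by
  rw [tTerm]; positivity

theorem tTerm_succ (q s m : ℕ) (hq : 0 < q) (hm : m ≤ q ^ s) :
    tTerm q s (m + 1) = tTerm q s m * ((1 - m / (q : ℝ) ^ s) / (m + 1)) := by
  have hQ : (0 : ℝ) < (q : ℝ) ^ s := by positivity
  have h := Nat.choose_succ_right_eq (q ^ s) m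
  have h' : ((q ^ s).choose (m + 1) : ℝ) * (m + 1) = (q ^ s).choose m * ((q : ℝ) ^ s - m) := by
    have := congrArg (Nat.cast (R := ℝ)) h
    rw [Nat.cast_mul, Nat.cast_mul, Nat.cast_sub hm] at this
    exact_mod_cast this
  have h2 : ((q ^ s).choose (m + 1) : ℝ) = (q ^ s).choose m * ((q : ℝ) ^ s - m) / (m + 1) := by
    rw [eq_div_iff (by positivity), h']
  rw [tTerm_eq, tTerm_eq, h2, pow_succ]
  field_simp

theorem tTerm_succ_le (q s m : ℕ) (hq : 0 < q) : tTerm q s (m + 1) ≤ tTerm q s m := by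
  by_cases hm : m ≤ q ^ s
  · rw [tTerm_succ q s m hq hm]
    refine mul_le_of_le_one_right (tTerm_nonneg _ _ _) ?_
    rw [div_le_one (by positivity)]
    have : (0 : ℝ) ≤ m / (q : ℝ) ^ s := by positivity
    linarith [(Nat.cast_nonneg m : (0 : ℝ) ≤ m)]
  · have : tTerm q s (m + 1) = 0 := by
      rw [tTerm, Nat.choose_eq_zero_of_lt (by omega)]; simp
    rw [this]; exact tTerm_nonneg _ _ _

theorem sAlt_succ (q s m : ℕ) :
    sAlt q s (m + 1) = sAlt q s m + (-1) ^ m * tTerm q s (m + 1) := by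
  rw [sAlt, Finset.sum_Icc_succ_top (by omega), sAlt, Nat.add_sub_cancel]

theorem sPlus_succ (q s m : ℕ) : sPlus q s (m + 1) = sPlus q s m + tTerm q s (m + 1) := by
  rw [sPlus, Finset.sum_Icc_succ_top (by omega), sPlus]

theorem sPlus_nonneg (q s m : ℕ) : 0 ≤ sPlus q s m :=
  Finset.sum_nonneg fun _ _ => tTerm_nonneg _ _ _

/-- With `x = q^(-s) ≤ 1/4` one has `s_2 = 1/2 + x/2` and `s_3 = 2/3 + x²/3 ≤ 2/3 + 1/48 = 11/16`.
-/
theorem sAlt_two_three (q s : ℕ) (hq : 0 < q) (hQ : 4 ≤ q ^ s) :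
    1 / 2 ≤ sAlt q s 2 ∧ sAlt q s 3 ≤ 11 / 16 := by
  have hQ' : (4 : ℝ) ≤ (q : ℝ) ^ s := by exact_mod_cast hQ
  have t0 : tTerm q s 0 = 1 := by simp [tTerm]
  have t1 : tTerm q s 1 = 1 := by
    rw [tTerm_succ q s 0 hq (by omega), t0]; simp
  have t2 := tTerm_succ q s 1 hq (by omega)
  have t3 := tTerm_succ q s 2 hq (by omega)
  have s0 : sAlt q s 0 = 0 := by simp [sAlt]
  have s1 := sAlt_succ q s 0
  have s2 := sAlt_succ q s 1
  have s3 := sAlt_succ q s 2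
  norm_num at t2 t3 s1 s2 s3
  rw [s3, s2, s1, s0, t3, t2, t1]
  set x := ((q : ℝ) ^ s)⁻¹ with hx
  have hx0 : 0 ≤ x := by positivity
  have hx1 : x ≤ 1 / 4 := by
    rw [hx, one_div]; exact inv_anti₀ (by norm_num) hQ'
  rw [div_eq_mul_inv 2 ((q : ℝ) ^ s), ← hx]
  constructor <;> nlinarith

/-- As `t_m` is nonincreasing, the even partial sums increase, the odd ones decrease, and each even
one lies below the next odd one; hence all lie between `s_2` and `s_3`. -/
theorem sAlt_mem_Icc (q s m : ℕ) (hq : 0 < q) (hQ : 4 ≤ q ^ s) (hm : 2 ≤ m) :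
    1 / 2 ≤ sAlt q s m ∧ sAlt q s m ≤ 11 / 16 := by
  have key : ∀ k : ℕ, 1 / 2 ≤ sAlt q s (2 * k + 2) ∧ sAlt q s (2 * k + 3) ≤ 11 / 16 := by
    intro k
    induction k with
    | zero => exact sAlt_two_three q s hq hQ
    | succ k ih =>
      have e1 : (-1 : ℝ) ^ (2 * k + 2) = 1 := (Even.neg_one_pow ⟨k + 1, by ring⟩)
      have e2 : (-1 : ℝ) ^ (2 * k + 3) = -1 := (Odd.neg_one_pow ⟨k + 1, by ring⟩)
      have e3 : (-1 : ℝ) ^ (2 * k + 4) = 1 := (Even.neg_one_pow ⟨k + 2, by ring⟩)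
      have a1 := sAlt_succ q s (2 * k + 2)
      have a2 := sAlt_succ q s (2 * k + 3)
      have a3 := sAlt_succ q s (2 * k + 4)
      have b1 := tTerm_succ_le q s (2 * k + 3) hq
      have b2 := tTerm_succ_le q s (2 * k + 4) hq
      simp only [Nat.add_assoc, Nat.reduceAdd] at a1 a2 a3 b1 b2
      rw [e1] at a1
      rw [e2] at a2
      rw [e3] at a3
      rw [show 2 * (k + 1) + 2 = 2 * k + 4 by ring, show 2 * (k + 1) + 3 = 2 * k + 5 by ring]
      constructor <;> linarith [ih.1, ih.2]
  have step : ∀ k : ℕ, sAlt q s (2 * k + 2) ≤ sAlt q s (2 * k + 3) := by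
    intro k
    have e1 : (-1 : ℝ) ^ (2 * k + 2) = 1 := (Even.neg_one_pow ⟨k + 1, by ring⟩)
    have a1 := sAlt_succ q s (2 * k + 2)
    rw [e1] at a1
    linarith [tTerm_nonneg q s (2 * k + 2 + 1)]
  obtain ⟨k, rfl | rfl⟩ : ∃ k, m = 2 * k + 2 ∨ m = 2 * k + 3 :=
    ⟨(m - 2) / 2, by omega⟩
  · exact ⟨(key k).1, (step k).trans (key k).2⟩
  · exact ⟨(key k).1.trans (step k), (key k).2⟩

/-- `x (1 - x)^m` is `7/16`-Lipschitz on `[1/2, 11/16]` for `m ≥ 1`. -/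
theorem abs_mul_one_sub_pow_sub_le (m : ℕ) (hm : 1 ≤ m) (x y : ℝ) (hx : 1 / 2 ≤ x)
    (hx' : x ≤ 11 / 16) (hy : 1 / 2 ≤ y) (hy' : y ≤ 11 / 16) :
    |x * (1 - x) ^ m - y * (1 - y) ^ m| ≤ 7 / 16 * |x - y| := by
  have h1 : |x * (1 - x) - y * (1 - y)| ≤ 3 / 8 * |x - y| := by
    rw [show x * (1 - x) - y * (1 - y) = (1 - x - y) * (x - y) by ring, abs_mul]
    refine mul_le_mul_of_nonneg_right ?_ (abs_nonneg _)
    rw [abs_le]; constructor <;> linarith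
  -- Since `1 - x ≤ 1/2`, a further factor halves the Lipschitz constant `L` and adds a bound `M`
  -- for the function itself. From `3/8` at exponent 1 this gives `3/16 + 1/4 = 7/16` at exponent 2;
  -- afterwards `7/32 + 1/8 < 7/16`.
  have step : ∀ (n : ℕ) (L M : ℝ), |x * (1 - x) ^ n - y * (1 - y) ^ n| ≤ L * |x - y| →
      y * (1 - y) ^ n ≤ M →
      |x * (1 - x) ^ (n + 1) - y * (1 - y) ^ (n + 1)| ≤ (L / 2 + M) * |x - y| := by
    intro n L M hL hM
    have hy0 : 0 ≤ y * (1 - y) ^ n := mul_nonneg (by linarith) (pow_nonneg (by linarith) _)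
    have e : x * (1 - x) ^ (n + 1) - y * (1 - y) ^ (n + 1) =
        (1 - x) * (x * (1 - x) ^ n - y * (1 - y) ^ n) + -((x - y) * (y * (1 - y) ^ n)) := by ring
    rw [e]
    refine (abs_add_le _ _).trans ?_
    rw [abs_neg, abs_mul, abs_mul, abs_of_nonneg (by linarith : 0 ≤ 1 - x), abs_of_nonneg hy0]
    have := abs_nonneg (x * (1 - x) ^ n - y * (1 - y) ^ n)
    nlinarith [abs_nonneg (x - y)]
  have hM1 : y * (1 - y) ^ 1 ≤ 1 / 4 := by nlinarith [sq_nonneg (y - 1 / 2)]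
  have hM2 : ∀ n : ℕ, y * (1 - y) ^ (n + 2) ≤ 1 / 8 := by
    intro n
    induction n with
    | zero =>
      have : y * (1 - y) ^ (0 + 2) = (y * (1 - y) ^ 1) * (1 - y) := by ring
      rw [this]; nlinarith
    | succ n ih =>
      rw [pow_succ, ← mul_assoc]
      have hy0 : 0 ≤ y * (1 - y) ^ (n + 2) :=
        mul_nonneg (by linarith) (pow_nonneg (by linarith) _)
      nlinarith
  have h2 : ∀ n : ℕ,
      |x * (1 - x) ^ (n + 2) - y * (1 - y) ^ (n + 2)| ≤ 7 / 16 * |x - y| := by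
    intro n
    induction n with
    | zero =>
      refine (step 1 (3 / 8) (1 / 4) (by simpa using h1) hM1).trans_eq ?_
      norm_num
    | succ n ih =>
      refine (step (n + 2) _ _ ih (hM2 n)).trans ?_
      exact mul_le_mul_of_nonneg_right (by norm_num) (abs_nonneg _)
  obtain rfl | ⟨n, rfl⟩ : m = 1 ∨ ∃ n, m = n + 2 := by
    rcases Nat.lt_or_ge m 2 with h | h
    · left; omega
    · right; exact ⟨m - 2, by omega⟩
  · simp only [pow_one]
    exact h1.trans (mul_le_mul_of_nonneg_right (by norm_num) (abs_nonneg _))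
  · exact h2 n

/-! ### Interpolation on affinely independent strips -/

open MvPolynomial in
/-- Arbitrary values at `m + 1` points are interpolated by a polynomial of degree at most `m`. -/
theorem exists_interpolating_totalDegree_le {K σ : Type*} [Field K] (m : ℕ)
    (T : Finset (σ → K)) (hT : T.card ≤ m + 1) (y : (σ → K) → K) :
    ∃ g : MvPolynomial σ K, g.totalDegree ≤ m ∧ ∀ x ∈ T, eval x g = y x := by
  classical
  have hsep : ∀ x x' : σ → K, ∃ l : MvPolynomial σ K, l.totalDegree ≤ 1 ∧
      eval x' l = 0 ∧ (x ≠ x' → eval x l = 1) := by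
    intro x x'
    by_cases h : x = x'
    · exact ⟨0, by simp, by simp, fun h' => absurd h h'⟩
    · obtain ⟨c, hc⟩ := Function.ne_iff.1 h
      refine ⟨C (x c - x' c)⁻¹ * (X c - C (x' c)), ?_, by simp, fun _ => ?_⟩
      · refine (totalDegree_mul _ _).trans ?_
        rw [totalDegree_C, zero_add]
        refine (totalDegree_sub _ _).trans ?_
        simp [totalDegree_X]
      · simp [inv_mul_cancel₀ (sub_ne_zero.2 hc)]
  choose l hl1 hl2 hl3 using hsep
  -- Lagrange interpolation, each basis polynomial being a product of at most `m` affine separating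
  -- forms.
  refine ⟨∑ x ∈ T, C (y x) * ∏ x' ∈ T.erase x, l x x', ?_, ?_⟩
  · refine totalDegree_finsetSum_le fun x hx => ?_
    refine (totalDegree_mul _ _).trans ?_
    rw [totalDegree_C, zero_add]
    refine (totalDegree_finsetProd _ _).trans ?_
    refine (Finset.sum_le_card_nsmul _ _ 1 fun x' _ => hl1 x x').trans ?_
    rw [Finset.card_erase_of_mem hx]
    simp only [smul_eq_mul, mul_one]; omega
  · intro x hx
    rw [map_sum, Finset.sum_eq_single x]
    · rw [map_mul, eval_C, map_prod, Finset.prod_eq_one, mul_one]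
      intro x' hx'
      exact hl3 x x' (Finset.ne_of_mem_erase hx').symm
    · intro z _ hzx
      rw [map_mul, map_prod, Finset.prod_eq_zero (Finset.mem_erase.2 ⟨hzx.symm, hx⟩) (hl2 z x),
        mul_zero]
    · exact fun h => absurd hx h

/-- A linear form on `Fin n → K` as a homogeneous polynomial of degree one. -/
theorem exists_polynomial_of_linearMap {K : Type*} [Field K] {n : ℕ}
    (f : (Fin n → K) →ₗ[K] K) : ∃ l : MvPolynomial (Fin n) K, l.totalDegree ≤ 1 ∧
      ∀ x, MvPolynomial.eval x l = f x := by
  classical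
  refine ⟨∑ i, MvPolynomial.C (f (Pi.single i 1)) * MvPolynomial.X i, ?_, fun x => ?_⟩
  · refine MvPolynomial.totalDegree_finsetSum_le fun i _ => ?_
    refine (MvPolynomial.totalDegree_mul _ _).trans ?_
    rw [MvPolynomial.totalDegree_C, MvPolynomial.totalDegree_X]
  · rw [LinearMap.pi_apply_eq_sum_univ f x]
    simp only [map_sum, map_mul, MvPolynomial.eval_C, MvPolynomial.eval_X, smul_eq_mul]
    refine Finset.sum_congr rfl fun i _ => ?_
    rw [mul_comm]
    congr 2
    ext j
    simp [Pi.single_apply, eq_comm]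

/-- Affine forms of degree one separating an affinely independent family from a base point. -/
theorem AffineIndependent.exists_separating {K ι : Type*} [Field K] [DecidableEq ι] {n : ℕ}
    {a : ι → Fin n → K} (ha : AffineIndependent K a) (k : ι) :
    ∃ l : ι → MvPolynomial (Fin n) K, (∀ i, (l i).totalDegree ≤ 1) ∧
      ∀ i, i ≠ k → ∀ j, MvPolynomial.eval (a j) (l i) = if j = i then 1 else 0 := by
  rw [affineIndependent_iff_linearIndependent_vsub K a k] at ha
  obtain ⟨g, hg⟩ := LinearMap.exists_leftInverse_of_injective _
    (LinearMap.ker_eq_bot.2 ha)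
  have hex : ∀ i, ∃ l : MvPolynomial (Fin n) K, l.totalDegree ≤ 1 ∧
      (i ≠ k → ∀ j, MvPolynomial.eval (a j) l = if j = i then 1 else 0) := by
    intro i
    by_cases hi : i = k
    · exact ⟨0, by simp, fun h => absurd hi h⟩
    · let f : (Fin n → K) →ₗ[K] K := (Finsupp.lapply ⟨i, hi⟩).comp g
      obtain ⟨l, hl, hl'⟩ := exists_polynomial_of_linearMap f
      refine ⟨l - MvPolynomial.C (f (a k)), ?_, fun _ j => ?_⟩
      · refine (MvPolynomial.totalDegree_sub _ _).trans ?_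
        simpa using hl
      · rw [map_sub, hl', MvPolynomial.eval_C, ← map_sub]
        by_cases hj : j = k
        · subst hj
          rw [sub_self, map_zero, if_neg (Ne.symm hi)]
        · have := LinearMap.congr_fun hg (Finsupp.single ⟨j, hj⟩ 1)
          simp only [LinearMap.comp_apply, Finsupp.linearCombination_single, one_smul,
            LinearMap.id_apply, vsub_eq_sub] at this
          simp only [f, LinearMap.comp_apply, this, Finsupp.lapply_apply,
            Finsupp.single_apply, Subtype.mk.injEq]
  choose l hl hl' using hex
  exact ⟨l, hl, hl'⟩

/-- The evaluations at the points of `{a_i} × T_i` are independent on polynomials of degree at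
most `d`, if the `a_i` are affinely independent and `T_i` has at most `d` points for `i ≠ k` and
at most `d + 1` points for `i = k`. -/
theorem exists_interpolating_on_strips {K ι : Type*} [Field K] [Fintype ι] [DecidableEq ι]
    {r s d : ℕ} (hd : 0 < d) (hsr : s ≤ r) {a : ι → Fin (r - s) → K}
    (ha : AffineIndependent K a) (T : ι → Finset (Fin s → K)) (k : ι)
    (hk : (T k).card ≤ d + 1) (hT : ∀ i, i ≠ k → (T i).card ≤ d) (y : ι → (Fin s → K) → K) :
    ∃ P : MvPolynomial (Fin r) K, P.totalDegree ≤ d ∧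
      ∀ i, ∀ x ∈ T i, MvPolynomial.eval (stripPoint (a i) x) P = y i x := by
  obtain ⟨l, hl, hl'⟩ := ha.exists_separating k
  obtain ⟨g₀, hg₀, hg₀'⟩ := exists_interpolating_totalDegree_le d (T k) hk (y k)
  -- Multiplication by `l i` uses up one degree, so `g i` has degree at most `d - 1` and handles
  -- only `d` points. The base strip `k`, where all the other `l i` vanish, sees `g₀` alone and so
  -- admits `d + 1` points; elsewhere `g i` corrects `g₀`.
  have hex : ∀ i, ∃ g : MvPolynomial (Fin s) K, g.totalDegree ≤ d - 1 ∧ (i ≠ k →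
      ∀ x ∈ T i, MvPolynomial.eval x g = y i x - MvPolynomial.eval x g₀) := by
    intro i
    by_cases hi : i = k
    · exact ⟨0, by simp, fun h => absurd hi h⟩
    · obtain ⟨g, hg, hg'⟩ := exists_interpolating_totalDegree_le (d - 1) (T i)
        ((hT i hi).trans (by omega)) fun x => y i x - MvPolynomial.eval x g₀
      exact ⟨g, hg, fun _ => hg'⟩
  choose g hg hg' using hex
  let ρa : Fin (r - s) → Fin r := Fin.castLE (Nat.sub_le r s)
  let ρx : Fin s → Fin r := fun i => ⟨(r - s) + i, by omega⟩
  have ea : ∀ (b : Fin (r - s) → K) x (p : MvPolynomial (Fin (r - s)) K),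
      MvPolynomial.eval (stripPoint b x) (MvPolynomial.rename ρa p) = MvPolynomial.eval b p := by
    intro b x p
    rw [MvPolynomial.eval_rename]
    congr 2
    ext i
    simp [stripPoint, ρa]
  have ex : ∀ (b : Fin (r - s) → K) x (p : MvPolynomial (Fin s) K),
      MvPolynomial.eval (stripPoint b x) (MvPolynomial.rename ρx p) = MvPolynomial.eval x p := by
    intro b x p
    rw [MvPolynomial.eval_rename]
    congr 2
    ext i
    simp [stripPoint, ρx]
  refine ⟨MvPolynomial.rename ρx g₀ + ∑ i ∈ Finset.univ.erase k,
    MvPolynomial.rename ρa (l i) * MvPolynomial.rename ρx (g i), ?_, fun i x hx => ?_⟩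
  · refine (MvPolynomial.totalDegree_add _ _).trans (max_le ?_ ?_)
    · exact (MvPolynomial.totalDegree_rename_le _ _).trans hg₀
    · refine MvPolynomial.totalDegree_finsetSum_le fun i _ => ?_
      refine (MvPolynomial.totalDegree_mul _ _).trans ?_
      have h1 := (MvPolynomial.totalDegree_rename_le ρa (l i)).trans (hl i)
      have h2 := (MvPolynomial.totalDegree_rename_le ρx (g i)).trans (hg i)
      omega
  · simp only [map_add, map_sum, map_mul, ea, ex]
    have hsum : ∀ j ∈ Finset.univ.erase k, MvPolynomial.eval (a i) (l j) *
        MvPolynomial.eval x (g j) = if i = j then MvPolynomial.eval x (g j) else 0 := by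
      intro j hj
      rw [hl' j (Finset.ne_of_mem_erase hj)]
      simp
    rw [Finset.sum_congr rfl hsum, Finset.sum_ite_eq]
    by_cases hi : i = k
    · subst hi
      simp [hg₀' x hx]
    · rw [if_pos (Finset.mem_erase.2 ⟨hi, Finset.mem_univ i⟩), hg' i hi x hx]
      ring

/-! ### Counting systems that vanish at prescribed points -/

instance finite_polysDegLE (K : Type*) [Field K] [Finite K] (r d : ℕ) :
    Finite (polysDegLE K r d) := by
  have h : Finite (MvPolynomial.restrictTotalDegree (Fin r) K d) := Module.finite_of_finite K
  exact Finite.of_injective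
    (fun F : polysDegLE K r d =>
      (⟨F.1, (MvPolynomial.mem_restrictTotalDegree _ _ _).2 F.2⟩ :
        MvPolynomial.restrictTotalDegree (Fin r) K d))
    fun F G h => Subtype.ext (congrArg (fun H : MvPolynomial.restrictTotalDegree (Fin r) K d =>
      (H : MvPolynomial (Fin r) K)) h)

/-- The number of polynomials of degree at most `d` that vanish on `{a_i} × T_i` for all `i`. -/
theorem card_vanishing_mul_pow {K ι : Type*} [Field K] [Fintype K] [Fintype ι]
    [DecidableEq ι] {r s d : ℕ} (hd : 0 < d) (hsr : s ≤ r) {a : ι → Fin (r - s) → K}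
    (ha : AffineIndependent K a) (T : ι → Finset (Fin s → K)) (k : ι)
    (hk : (T k).card ≤ d + 1) (hT : ∀ i, i ≠ k → (T i).card ≤ d) :
    Nat.card {F : polysDegLE K r d //
        ∀ i, ∀ x ∈ T i, MvPolynomial.eval (stripPoint (a i) x) F.1 = 0} *
      Fintype.card K ^ (∑ i, (T i).card) = Nat.card (polysDegLE K r d) := by
  classical
  let V := MvPolynomial.restrictTotalDegree (Fin r) K d
  let ev : V →ₗ[K] ((Σ i, T i) → K) := LinearMap.pi fun p =>
    (MvPolynomial.aeval (stripPoint (a p.1) p.2.1) : MvPolynomial (Fin r) K →ₐ[K] K).toLinearMap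
      ∘ₗ V.subtype
  have hev : ∀ F p, ev F p = MvPolynomial.eval (stripPoint (a p.1) p.2.1) F.1 := fun F p => by
    simp [ev, MvPolynomial.aeval_eq_eval]
  have hsurj : Function.Surjective ev := by
    intro y
    obtain ⟨P, hP, hP'⟩ := exists_interpolating_on_strips hd hsr ha T k hk hT
      (fun i x => if h : x ∈ T i then y ⟨i, x, h⟩ else 0)
    refine ⟨⟨P, (MvPolynomial.mem_restrictTotalDegree _ _ _).2 hP⟩, ?_⟩
    ext ⟨i, x, hx⟩
    rw [hev]
    simp only [hP' i x hx, hx, dif_pos]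
  -- Interpolation makes evaluation surjective, so the vanishing polynomials form a kernel of index
  -- `q ^ ∑ #T_i`.
  have hq := Submodule.card_eq_card_quotient_mul_card (LinearMap.ker ev)
  rw [Nat.card_congr (ev.quotKerEquivOfSurjective hsurj).toEquiv] at hq
  have hY : Nat.card ((Σ i, T i) → K) = Fintype.card K ^ (∑ i, (T i).card) := by
    rw [Nat.card_eq_fintype_card, Fintype.card_fun, Fintype.card_sigma]
    simp
  have hV : Nat.card (polysDegLE K r d) = Nat.card V :=
    Nat.card_congr (Equiv.subtypeEquivRight fun F =>
      (MvPolynomial.mem_restrictTotalDegree _ _ _).symm)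
  rw [hV, hq, hY]
  congr 1
  refine Nat.card_congr ?_
  refine
    { toFun := fun F => ⟨⟨F.1.1, (MvPolynomial.mem_restrictTotalDegree _ _ _).2 F.1.2⟩, ?_⟩
      invFun := fun F => ⟨⟨F.1.1, (MvPolynomial.mem_restrictTotalDegree _ _ _).1 F.1.2⟩, ?_⟩
      left_inv := fun F => rfl
      right_inv := fun F => rfl }
  · rw [LinearMap.mem_ker]
    ext ⟨i, x, hx⟩
    rw [hev]
    exact F.2 i x hx
  · intro i x hx
    have := congrFun (LinearMap.mem_ker.1 F.2) ⟨i, x, hx⟩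
    rwa [hev] at this

/-- The number of systems of `m` polynomials that vanish on `{a_i} × T_i` for all `i`. -/
theorem card_systems_vanishing {K ι : Type*} [Field K] [Fintype K] [Fintype ι]
    [DecidableEq ι] {r s d : ℕ} (m : ℕ) (hd : 0 < d) (hsr : s ≤ r) {a : ι → Fin (r - s) → K}
    (ha : AffineIndependent K a) (T : ι → Finset (Fin s → K)) (k : ι)
    (hk : (T k).card ≤ d + 1) (hT : ∀ i, i ≠ k → (T i).card ≤ d) :
    (Nat.card {F : Fin m → polysDegLE K r d //
        ∀ j i, ∀ x ∈ T i, MvPolynomial.eval (stripPoint (a i) x) (F j).1 = 0} : ℝ) =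
      (Nat.card (polysDegLE K r d) : ℝ) ^ m *
        ∏ i, (((Fintype.card K : ℝ) ^ m)⁻¹) ^ (T i).card := by
  have h := card_vanishing_mul_pow hd hsr ha T k hk hT
  have hW : Nat.card {F : Fin m → polysDegLE K r d //
        ∀ j i, ∀ x ∈ T i, MvPolynomial.eval (stripPoint (a i) x) (F j).1 = 0} =
      (Nat.card {F : polysDegLE K r d //
        ∀ i, ∀ x ∈ T i, MvPolynomial.eval (stripPoint (a i) x) F.1 = 0}) ^ m := by
    rw [Nat.card_congr (Equiv.subtypePiEquivPi
      (p := fun (_ : Fin m) (F : polysDegLE K r d) =>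
        ∀ i, ∀ x ∈ T i, MvPolynomial.eval (stripPoint (a i) x) F.1 = 0))]
    simp [Nat.card_fun]
  rw [hW, ← h, Finset.prod_pow_eq_pow_sum]
  have hq : (Fintype.card K : ℝ) ≠ 0 := by simp [Fintype.card_ne_zero]
  push_cast
  rw [mul_pow, ← pow_mul, inv_pow, ← pow_mul, mul_comm m]
  field_simp

/-! ### Affinely dependent tuples are rare -/

/-- Embeddings of `ι` satisfying a fixed relation that determines the value at `i₀`. -/
theorem card_embedding_le_of_determined {ι W : Type*} [Fintype ι] [DecidableEq ι] [Fintype W]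
    (i₀ : ι) (s : Finset (ι ↪ W))
    (hs : ∀ a ∈ s, ∀ b ∈ s, (∀ i ≠ i₀, a i = b i) → a = b) :
    s.card ≤ (Fintype.card W).descFactorial (Fintype.card ι - 1) := by
  classical
  let res : (ι ↪ W) → ({i // i ≠ i₀} ↪ W) := fun a => (Function.Embedding.subtype _).trans a
  have hinj : Set.InjOn res s := by
    intro a ha b hb hab
    refine hs a ha b hb fun i hi => ?_
    exact congrArg (fun f : {i // i ≠ i₀} ↪ W => f ⟨i, hi⟩) hab
  refine (Finset.card_le_card_of_injOn res (fun _ _ => Finset.mem_univ _) hinj).trans ?_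
  rw [Finset.card_univ, Fintype.card_embedding_eq]
  simp [Fintype.card_subtype_compl]

/-- The affinely dependent tuples of `n + 1` distinct points of an `m`-dimensional space,
`n ≤ m`, form a fraction of at most `1 / (q - 1)` of all tuples of distinct points. -/
theorem card_not_affineIndependent_mul_le {K W ι : Type*} [Field K] [Fintype K] [AddCommGroup W]
    [Module K W] [Fintype W] [Fintype ι] [Nonempty ι]
    (hcard : Fintype.card K ^ (Fintype.card ι - 1) ≤ Fintype.card W) :
    (Fintype.card K - 1) * Nat.card {a : ι ↪ W // ¬ AffineIndependent K a} ≤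
      Nat.card (ι ↪ W) := by
  classical
  obtain ⟨i₀⟩ := ‹Nonempty ι›
  set q := Fintype.card K with hq
  set N := Fintype.card W with hN
  set h := Fintype.card ι with hh
  have hh0 : 0 < h := Fintype.card_pos_iff.2 ⟨i₀⟩
  let J := {i : ι // i ≠ i₀}
  have hJ : Fintype.card J = h - 1 := by simp [J, Fintype.card_subtype_compl, hh]
  let rel : (J → K) → (ι ↪ W) → Prop := fun c a => ∑ j : J, c j • (a j - a i₀) = 0
  let bad : Finset (ι ↪ W) := Finset.univ.filter fun a => ¬ AffineIndependent K a
  -- Zero is no relation, and a unit vector cannot be one since the points are distinct. Discarding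
  -- these `h` vectors makes the final count exact enough.
  let R : Finset (J → K) := Finset.univ.filter fun c => c ≠ 0 ∧ ∀ j, c ≠ Pi.single j 1
  have hone : ∀ (a : ι ↪ W) (j : J), a j - a i₀ ≠ 0 := fun a j h =>
    j.2 (a.injective (sub_eq_zero.1 h))
  have hR : R.card + h ≤ q ^ (h - 1) := by
    let e : Option J → (J → K) := fun o => o.elim 0 fun j => Pi.single j 1
    have he : Function.Injective e := by
      rintro (_ | i) (_ | j) hij
      · rfl
      · have := congrFun hij j; simp [e] at this
      · have := congrFun hij i; simp [e] at this
      · have := congrFun hij j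
        by_cases hij' : i = j
        · rw [hij']
        · simp [e, Ne.symm hij'] at this
    have h1 : (Finset.univ.image e).card = h := by
      rw [Finset.card_image_of_injective _ he, Finset.card_univ, Fintype.card_option, hJ]; omega
    have h2 : Disjoint R (Finset.univ.image e) := by
      rw [Finset.disjoint_left]
      intro c hc hc'
      simp only [R, Finset.mem_filter, Finset.mem_univ, true_and] at hc
      obtain ⟨o, -, rfl⟩ := Finset.mem_image.1 hc'
      cases o with
      | none => exact hc.1 rfl
      | some j => exact hc.2 j rfl
    have h3 := Finset.card_le_univ (R ∪ Finset.univ.image e)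
    rwa [Finset.card_union_of_disjoint h2, h1, Fintype.card_fun, hJ] at h3
  -- The nonzero multiples of one relation are `q - 1` relations.
  have hfib : ∀ a ∈ bad, q - 1 ≤ (Finset.bipartiteBelow rel R a).card := by
    intro a ha
    have hdep : ¬ AffineIndependent K a := (Finset.mem_filter.1 ha).2
    rw [affineIndependent_iff_linearIndependent_vsub K a i₀,
      Fintype.not_linearIndependent_iff] at hdep
    obtain ⟨c, hc, j₀, hj₀⟩ := hdep
    have hc' : rel c a := hc
    have hunits : Fintype.card Kˣ = q - 1 := Fintype.card_units K
    rw [← hunits, ← Finset.card_univ]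
    refine Finset.card_le_card_of_injOn (fun l : Kˣ => fun j => (l : K) * c j) ?_ ?_
    · intro l _
      simp only [Finset.coe_filter, Finset.bipartiteBelow, Set.mem_ofPred_eq, R,
        Finset.mem_filter, Finset.mem_univ, true_and]
      have hrel : rel (fun j => (l : K) * c j) a := by
        simp only [rel, mul_smul, ← Finset.smul_sum]
        rw [show ∑ j : J, c j • (a j - a i₀) = 0 from hc', smul_zero]
      refine ⟨⟨fun h0 => ?_, fun j hj => ?_⟩, hrel⟩
      · have := congrFun h0 j₀
        simp [hj₀] at this
      · rw [hj] at hrel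
        simp only [rel] at hrel
        rw [Finset.sum_eq_single j (fun i _ hi => by rw [Pi.single_eq_of_ne hi, zero_smul])
          (fun h => absurd (Finset.mem_univ j) h), Pi.single_eq_same, one_smul] at hrel
        exact hone a j hrel
    · intro l _ l' _ hll
      have := congrFun hll j₀
      exact Units.ext (mul_right_cancel₀ hj₀ this)
  -- A relation with `c j₀ ≠ 0` determines `a j₀` from the other points.
  have hcol : ∀ c ∈ R, (Finset.bipartiteAbove rel bad c).card ≤ N.descFactorial (h - 1) := by
    intro c hc
    simp only [R, Finset.mem_filter, Finset.mem_univ, true_and] at hc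
    obtain ⟨j₀, hj₀⟩ := Function.ne_iff.1 hc.1
    refine card_embedding_le_of_determined (j₀ : ι) _ fun a ha b hb hab => ?_
    have ha' : rel c a := (Finset.mem_filter.1 ha).2
    have hb' : rel c b := (Finset.mem_filter.1 hb).2
    have h0 : a i₀ = b i₀ := hab _ (Ne.symm j₀.2)
    simp only [rel] at ha' hb'
    rw [← Finset.add_sum_erase _ _ (Finset.mem_univ j₀)] at ha' hb'
    have hsum : ∑ j ∈ Finset.univ.erase j₀, c j • (a j - a i₀) =
        ∑ j ∈ Finset.univ.erase j₀, c j • (b j - b i₀) := by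
      refine Finset.sum_congr rfl fun j hj => ?_
      rw [hab j fun h => Finset.ne_of_mem_erase hj (Subtype.ext h), h0]
    rw [hsum, ← hb'] at ha'
    have h1 := smul_right_injective W hj₀ (add_right_cancel ha')
    rw [h0] at h1
    have h2 : a j₀ = b j₀ := sub_left_injective h1
    ext i
    by_cases hi : i = j₀
    · rw [hi, h2]
    · exact hab i hi
  have hdc : bad.card * (q - 1) ≤ R.card * N.descFactorial (h - 1) :=
    Finset.card_mul_le_card_mul (fun a c => rel c a) hfib hcol
  have hbad : Nat.card {a : ι ↪ W // ¬ AffineIndependent K a} = bad.card := by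
    rw [Nat.card_eq_fintype_card, Fintype.card_subtype]
  rw [hbad, Nat.card_eq_fintype_card, Fintype.card_embedding_eq, mul_comm]
  refine hdc.trans ?_
  -- There are `(N - (h - 1)) * N.descFactorial (h - 1)` tuples in all, and `#R ≤ q^(h-1) - h ≤ N -
  -- (h - 1)`.
  obtain ⟨n, hn⟩ : ∃ n, h = n + 1 := ⟨h - 1, by omega⟩
  rw [← hh, ← hN, hn, Nat.descFactorial_succ, Nat.add_sub_cancel]
  refine Nat.mul_le_mul_right _ ?_
  rw [hn] at hR hcard
  simp only [Nat.add_sub_cancel] at hR hcard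
  omega

/-! ### The estimate when the zero polynomial is admitted -/

theorem stripsNeeded_eq_last_iff {K : Type*} [Field K] {r s n : ℕ}
    {Fam : Set (MvPolynomial (Fin r) K)} (w : SearchSpace Fam s (n + 1)) :
    stripsNeeded w = ((n + 1 : ℕ) : ℕ∞) ↔
      ∀ i, (i = Fin.last n ↔ 0 < numZeros (fun j => specialize (w.1 i) (w.2 j).1)) := by
  constructor
  · intro h
    have h1 : ∀ i, 0 < numZeros (fun j => specialize (w.1 i) (w.2 j).1) → i = Fin.last n := by
      intro i hi
      have := iInf₂_le (f := fun (j : Fin (n + 1))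
        (_ : 0 < numZeros (fun i => specialize (w.1 j) (w.2 i).1)) =>
          (((j : ℕ) + 1 : ℕ) : ℕ∞)) i hi
      change stripsNeeded w ≤ _ at this
      rw [h, Nat.cast_le] at this
      exact Fin.ext (by rw [Fin.val_last]; omega)
    refine fun i => ⟨?_, h1 i⟩
    rintro rfl
    by_contra hneg
    -- Without a zero in the last strip there would be none in any strip, and the value would be
    -- infinite.
    have : stripsNeeded w = ⊤ := by
      refine iInf₂_eq_top.2 fun j hj => ?_
      obtain rfl := h1 j hj
      exact absurd hj hneg
    rw [this] at h
    exact ENat.natCast_ne_top _ h.symm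
  · intro h
    refine le_antisymm ?_ ?_
    · exact iInf₂_le (f := fun (j : Fin (n + 1))
        (_ : 0 < numZeros (fun i => specialize (w.1 j) (w.2 i).1)) =>
          (((j : ℕ) + 1 : ℕ) : ℕ∞)) (Fin.last n) ((h _).1 rfl)
    · refine le_iInf₂ fun j hj => ?_
      rw [(h j).2 hj, Fin.val_last]

theorem numZeros_specialize_pos_iff {K : Type*} [Field K] [Finite K] {r s : ℕ}
    (a : Fin (r - s) → K) (F : Fin s → MvPolynomial (Fin r) K) :
    0 < numZeros (fun j => specialize a (F j)) ↔
      ∃ x, ∀ j, MvPolynomial.eval (stripPoint a x) (F j) = 0 := by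
  rw [numZeros, Set.ncard_pos (Set.toFinite _)]
  simp only [eval_specialize]
  rfl

/-- The estimate for a fixed affinely independent tuple of strips. -/
theorem abs_card_first_hit_sub_le {K : Type*} [Field K] [Fintype K] {r s d n : ℕ}
    (hd : 0 < d) (hsr : s ≤ r) {a : Fin (n + 1) → Fin (r - s) → K}
    (ha : AffineIndependent K a) :
    |(Nat.card {F : Fin s → polysDegLE K r d // ∀ i, (i = Fin.last n ↔
        0 < numZeros (fun j => specialize (a i) (F j).1))} : ℝ) -
      (Nat.card (polysDegLE K r d) : ℝ) ^ s * (sAlt (Fintype.card K) s d *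
        (1 - sAlt (Fintype.card K) s d) ^ n)| ≤
    (Nat.card (polysDegLE K r d) : ℝ) ^ s *
      (tTerm (Fintype.card K) s (d + 1) * (1 + sPlus (Fintype.card K) s d) ^ n) := by
  classical
  have : Fintype (polysDegLE K r d) := Fintype.ofFinite _
  have key := abs_card_sub_le_of_indep (n := n) (d := d)
    (fun (i : Fin (n + 1)) (F : Fin s → polysDegLE K r d) =>
      Finset.univ.filter fun x : Fin s → K =>
        ∀ j, MvPolynomial.eval (stripPoint (a i) x) (F j).1 = 0)
    ((Nat.card (polysDegLE K r d) : ℝ) ^ s) (((Fintype.card K : ℝ) ^ s)⁻¹)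
    (tTerm (Fintype.card K) s) (fun j => by rw [tTerm_eq]; simp)
    (fun T k hk hT => by
      rw [← card_systems_vanishing s hd hsr ha T k hk hT, Nat.card_eq_fintype_card,
        Fintype.card_subtype]
      congr 2
      ext F
      simp only [Finset.mem_filter, Finset.mem_univ, true_and, Finset.subset_iff]
      exact ⟨fun h j i x hx => h i hx j, fun h i x hx j => h j i x hx⟩)
  change |_ - _ * (sAlt _ _ _ * (1 - sAlt _ _ _) ^ n)| ≤ _ * (_ * (1 + sPlus _ _ _) ^ n) at key
  convert key using 4
  rw [Nat.card_eq_fintype_card, Fintype.card_subtype]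
  congr 1
  ext F
  simp only [Finset.mem_filter, Finset.mem_univ, true_and, numZeros_specialize_pos_iff,
    ← Finset.nonempty_iff_ne_empty, Finset.filter_nonempty_iff]

theorem two_div_card_bound {q M b : ℕ} (hq : 2 ≤ q) (h : (q - 1) * b ≤ M) :
    (b : ℝ) ≤ 2 / (q : ℝ) * M := by
  have h1 : q * b ≤ 2 * M := by
    have : q * b ≤ (2 * (q - 1)) * b := Nat.mul_le_mul_right _ (by omega)
    nlinarith
  have h2 : (q : ℝ) * b ≤ 2 * M := by exact_mod_cast h1
  rw [div_mul_eq_mul_div, le_div_iff₀ (by positivity)]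
  linarith

theorem probStripsNeeded_eq {K : Type*} [Field K] [Fintype K] {r s n : ℕ}
    (Fam : Set (MvPolynomial (Fin r) K)) [Finite Fam] :
    probStripsNeeded Fam s (n + 1) =
      (∑ a : Fin (n + 1) ↪ (Fin (r - s) → K),
        (Nat.card {F : Fin s → Fam // ∀ i, (i = Fin.last n ↔
          0 < numZeros (fun j => specialize (a i) (F j).1))} : ℝ)) /
      (Nat.card (Fin (n + 1) ↪ (Fin (r - s) → K)) * (Nat.card Fam : ℝ) ^ s) := by
  rw [probStripsNeeded]
  congr 1
  · simp only [stripsNeeded_eq_last_iff]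
    rw [← Nat.card_coe_set_eq]
    refine (congrArg Nat.cast (Nat.card_congr (Equiv.subtypeProdEquivSigmaSubtype
      (fun (a : Fin (n + 1) ↪ (Fin (r - s) → K)) (F : Fin s → Fam) => ∀ i, (i = Fin.last n ↔
          0 < numZeros (fun j => specialize (a i) (F j).1)))))).trans ?_
    rw [Nat.card_sigma]
    push_cast
    rfl
  · rw [Nat.card_prod, Nat.card_fun]
    simp

/-- The estimate for the family that contains the zero polynomial. -/
theorem abs_probStripsNeeded_polysDegLE_sub_le {K : Type*} [Field K] [Fintype K] {r s d n : ℕ}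
    (hd : 2 ≤ d) (hsr : s ≤ r) (hn : n ≤ r - s) (hQ : 4 ≤ Fintype.card K ^ s) :
    |probStripsNeeded (polysDegLE K r d) s (n + 1) - sAlt (Fintype.card K) s d *
        (1 - sAlt (Fintype.card K) s d) ^ n| ≤
      tTerm (Fintype.card K) s (d + 1) * (1 + sPlus (Fintype.card K) s d) ^ n +
        2 / (Fintype.card K : ℝ) := by
  classical
  set q := Fintype.card K with hq
  have hq2 : 2 ≤ q := Fintype.one_lt_card
  set V := (Nat.card (polysDegLE K r d) : ℝ) ^ s with hV
  set τ := sAlt q s d * (1 - sAlt q s d) ^ n with hτ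
  set B := tTerm q s (d + 1) * (1 + sPlus q s d) ^ n with hB
  have hB0 : 0 ≤ B :=
    mul_nonneg (tTerm_nonneg _ _ _) (pow_nonneg (by linarith [sPlus_nonneg q s d]) _)
  have hne : Nonempty (polysDegLE K r d) := ⟨⟨0, by simp [polysDegLE]⟩⟩
  have hV0 : 0 < V := pow_pos (Nat.cast_pos.2 Nat.card_pos) _
  obtain ⟨hs0, hs1⟩ := sAlt_mem_Icc q s d (by omega) hQ hd
  have hτ0 : 0 ≤ τ := mul_nonneg (by linarith) (pow_nonneg (by linarith) _)
  have hτ1 : τ ≤ 1 := mul_le_one₀ (by linarith) (pow_nonneg (by linarith) _)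
    (pow_le_one₀ (by linarith) (by linarith))
  set M := Nat.card (Fin (n + 1) ↪ (Fin (r - s) → K)) with hM
  have hcardW : Fintype.card (Fin (r - s) → K) = q ^ (r - s) := by simp [hq]
  have hM0 : 0 < M := by
    rw [hM, Nat.card_eq_fintype_card, Fintype.card_embedding_eq, hcardW, Fintype.card_fin]
    refine Nat.descFactorial_pos.2 ?_
    have := Nat.lt_pow_self (n := r - s) (by omega : 1 < q)
    omega
  let cnt : (Fin (n + 1) ↪ (Fin (r - s) → K)) → ℝ := fun a =>
    (Nat.card {F : Fin s → polysDegLE K r d // ∀ i, (i = Fin.last n ↔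
      0 < numZeros (fun j => specialize (a i) (F j).1))} : ℝ)
  have hbad : ((Finset.univ.filter fun a : Fin (n + 1) ↪ (Fin (r - s) → K) =>
      ¬ AffineIndependent K a).card : ℝ) ≤ 2 / (q : ℝ) * M := by
    refine two_div_card_bound hq2 ?_
    have := card_not_affineIndependent_mul_le (K := K) (W := Fin (r - s) → K)
      (ι := Fin (n + 1)) (by
        rw [hcardW, Fintype.card_fin, Nat.add_sub_cancel]
        exact Nat.pow_le_pow_right (by omega) hn)
    rw [Nat.card_eq_fintype_card, Fintype.card_subtype] at this
    exact this
  -- For dependent tuples the trivial bound `V` suffices, since both `cnt a` and `V * τ` lie in `[0,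
  -- V]`.
  have hpt : ∀ a, |cnt a - V * τ| ≤
      V * B + V * (if ¬ AffineIndependent K a then 1 else 0) := by
    intro a
    by_cases ha : AffineIndependent K a
    · rw [if_neg (not_not.2 ha), mul_zero, add_zero]
      exact abs_card_first_hit_sub_le (by omega) hsr ha
    · rw [if_pos ha]
      have h1 : 0 ≤ cnt a := Nat.cast_nonneg _
      have h2 : cnt a ≤ V := by
        have h3 : Nat.card (Fin s → polysDegLE K r d) = Nat.card (polysDegLE K r d) ^ s := by
          rw [Nat.card_fun, Nat.card_eq_fintype_card (α := Fin s), Fintype.card_fin]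
        rw [hV, ← Nat.cast_pow, ← h3]
        exact Nat.cast_le.2 (Nat.card_le_card_of_injective _ Subtype.val_injective)
      rw [abs_le]
      constructor <;> nlinarith
  rw [probStripsNeeded_eq]
  have hMV : 0 < (M : ℝ) * V := mul_pos (Nat.cast_pos.2 hM0) hV0
  have hcard : ∑ _a : Fin (n + 1) ↪ (Fin (r - s) → K), (1 : ℝ) = M := by
    rw [hM, Nat.card_eq_fintype_card]; simp
  have hsum : |∑ a, cnt a - M * V * τ| ≤ M * V * (B + 2 / q) := by
    have h1 : ∑ a, cnt a - M * V * τ = ∑ a, (cnt a - V * τ) := by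
      rw [Finset.sum_sub_distrib, ← hcard, mul_assoc, Finset.sum_mul]; simp
    rw [h1]
    refine (Finset.abs_sum_le_sum_abs _ _).trans ((Finset.sum_le_sum fun a _ => hpt a).trans ?_)
    rw [Finset.sum_add_distrib, ← Finset.mul_sum (f := fun a : Fin (n + 1) ↪ (Fin (r - s) → K) =>
      if ¬ AffineIndependent K a then (1 : ℝ) else 0), Finset.sum_boole]
    have h2 : ∑ _a : Fin (n + 1) ↪ (Fin (r - s) → K), V * B = M * (V * B) := by
      rw [← hcard, Finset.sum_mul]; simp
    rw [h2]
    nlinarith [mul_le_mul_of_nonneg_left hbad hV0.le]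
  change |(∑ a, cnt a) / (M * V) - τ| ≤ _
  rw [div_sub' hMV.ne', abs_div, abs_of_pos hMV, div_le_iff₀ hMV]
  linarith

/-! ### Excluding the zero polynomial -/

/-- Conditioning the uniform distribution on a subset changes a probability by at most the
probability of the complement. -/
theorem abs_ncard_preimage_div_sub_le {Ω Ω' : Type*} [Finite Ω] [Finite Ω'] (f : Ω' → Ω)
    (hf : Function.Injective f) (E : Set Ω) :
    |((f ⁻¹' E).ncard : ℝ) / Nat.card Ω' - (E.ncard : ℝ) / Nat.card Ω| ≤
      1 - (Nat.card Ω' : ℝ) / Nat.card Ω := by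
  rcases Nat.eq_zero_or_pos (Nat.card Ω) with h0 | h0
  · have h1 : Nat.card Ω' = 0 := Nat.le_zero.1 (h0 ▸ Nat.card_le_card_of_injective f hf)
    simp [h0, h1]
  have hN : (0 : ℝ) < Nat.card Ω := Nat.cast_pos.2 h0
  have himg : (f '' (f ⁻¹' E)).ncard = (f ⁻¹' E).ncard := Set.ncard_image_of_injective _ hf
  have h1 : (f ⁻¹' E).ncard ≤ E.ncard :=
    himg ▸ Set.ncard_le_ncard (Set.image_preimage_subset f E) (Set.toFinite _)
  have hrange : (Set.range f).ncard = Nat.card Ω' := by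
    rw [← Set.image_univ, Set.ncard_image_of_injective _ hf, Set.ncard_univ]
  have h2 : E.ncard + Nat.card Ω' ≤ (f ⁻¹' E).ncard + Nat.card Ω := by
    have ha : E.ncard ≤ (f '' (f ⁻¹' E)).ncard + (Set.range f)ᶜ.ncard := by
      refine (Set.ncard_le_ncard ?_ (Set.toFinite _)).trans (Set.ncard_union_le _ _)
      intro x hx
      by_cases hxr : x ∈ Set.range f
      · obtain ⟨y, rfl⟩ := hxr
        exact Or.inl ⟨y, hx, rfl⟩
      · exact Or.inr hxr
    have hb := Set.ncard_add_ncard_compl (Set.range f)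
    omega
  have h3 : (f ⁻¹' E).ncard ≤ Nat.card Ω' := by
    rw [← Set.ncard_univ]; exact Set.ncard_le_ncard (Set.subset_univ _) (Set.toFinite _)
  have h4 : Nat.card Ω' ≤ Nat.card Ω := Nat.card_le_card_of_injective f hf
  set y : ℝ := ((f ⁻¹' E).ncard : ℝ)
  set x : ℝ := (E.ncard : ℝ)
  set N' : ℝ := (Nat.card Ω' : ℝ) with hN'
  set N : ℝ := (Nat.card Ω : ℝ)
  have h1' : y ≤ x := Nat.cast_le.2 h1
  have h2' : x + N' ≤ y + N := by
    simp only [x, y, N, hN', ← Nat.cast_add]; exact Nat.cast_le.2 h2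
  have h3' : y ≤ N' := Nat.cast_le.2 h3
  have h4' : N' ≤ N := Nat.cast_le.2 h4
  have hy0 : 0 ≤ y := Nat.cast_nonneg _
  have hN0 : 0 ≤ N' := Nat.cast_nonneg _
  have hr0 : 0 ≤ y / N' := div_nonneg hy0 hN0
  have hr1 : y / N' ≤ 1 := div_le_one_of_le₀ h3' hN0
  -- This survives `N' = 0`, where `y = 0` too.
  have hyr : y = y / N' * N' := by
    rcases hN0.eq_or_lt with h | h
    · rw [← h, mul_zero]; exact le_antisymm (h ▸ h3') hy0
    · rw [div_mul_cancel₀ _ h.ne']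
  set ρ := y / N'
  have e1 : ρ - x / N = (ρ * N - x) / N := by field_simp
  have e2 : 1 - N' / N = (N - N') / N := by field_simp
  rw [e1, e2, abs_div, abs_of_pos hN]
  refine div_le_div_of_nonneg_right ?_ hN.le
  rw [abs_le]
  constructor <;> nlinarith

theorem ncard_polysDegLE_diff_zero (K : Type*) [Field K] [Finite K] (r d : ℕ) :
    Nat.card (polysDegLE K r d \ {0} : Set (MvPolynomial (Fin r) K)) + 1 =
      Nat.card (polysDegLE K r d) := by
  rw [Nat.card_coe_set_eq, Nat.card_coe_set_eq]
  exact Set.ncard_sdiff_singleton_add_one (by simp [polysDegLE]) (Set.toFinite _)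

/-- Excluding zero conditions on an event whose complement has probability `1 - (1 - 1/#V)^s`, at
most `s/#V` by Bernoulli's inequality. -/
theorem abs_probStripsNeeded_diff_zero_sub_le {K : Type*} [Field K] [Fintype K] {r s d n : ℕ}
    (hn : n ≤ r - s) :
    |probStripsNeeded (polysDegLE K r d \ {0}) s (n + 1) -
      probStripsNeeded (polysDegLE K r d) s (n + 1)| ≤
      (s : ℝ) / Nat.card (polysDegLE K r d) := by
  set V := Nat.card (polysDegLE K r d) with hV
  have hV1 := ncard_polysDegLE_diff_zero K r d
  rw [← hV] at hV1
  have : Finite (polysDegLE K r d \ {0} : Set (MvPolynomial (Fin r) K)) :=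
    Set.toFinite _
  let inc : (polysDegLE K r d \ {0} : Set (MvPolynomial (Fin r) K)) → polysDegLE K r d :=
    Set.inclusion Set.sdiff_subset
  let f : SearchSpace (polysDegLE K r d \ {0}) s (n + 1) →
      SearchSpace (polysDegLE K r d) s (n + 1) := fun w => (w.1, fun j => inc (w.2 j))
  have hf : Function.Injective f := by
    rintro ⟨a, F⟩ ⟨b, G⟩ h
    simp only [f, Prod.mk.injEq] at h
    refine Prod.ext h.1 (funext fun j => ?_)
    exact Set.inclusion_injective Set.sdiff_subset (congrFun h.2 j)
  have key := abs_ncard_preimage_div_sub_le f hf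
    {w | stripsNeeded w = ((n + 1 : ℕ) : ℕ∞)}
  refine (show _ ≤ _ from key).trans ?_
  have hM0 : 0 < Nat.card (Fin (n + 1) ↪ (Fin (r - s) → K)) := by
    rw [Nat.card_eq_fintype_card, Fintype.card_embedding_eq, Fintype.card_fin]
    refine Nat.descFactorial_pos.2 ?_
    have := Nat.lt_pow_self (n := r - s) (Fintype.one_lt_card : 1 < Fintype.card K)
    simp only [Fintype.card_fun, Fintype.card_fin]
    omega
  have hV0 : (0 : ℝ) < V := by rw [← hV1]; positivity
  rw [Nat.card_prod, Nat.card_prod, Nat.card_fun, Nat.card_fun, Nat.card_eq_fintype_card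
    (α := Fin s), Fintype.card_fin, ← hV]
  push_cast
  rw [mul_div_mul_left _ _ (Nat.cast_ne_zero.2 hM0.ne'), ← div_pow]
  have h1 : (Nat.card (polysDegLE K r d \ {0} : Set (MvPolynomial (Fin r) K)) : ℝ) / V =
      1 + -(1 / (V : ℝ)) := by
    rw [← hV1]; push_cast; field_simp; ring
  rw [h1]
  have h2 : 1 / (V : ℝ) ≤ 1 := by
    rw [div_le_one hV0, ← hV1]; push_cast; linarith [Nat.cast_nonneg (α := ℝ)
      (Nat.card (polysDegLE K r d \ {0} : Set (MvPolynomial (Fin r) K)))]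
  have h3 := one_add_mul_le_pow (a := -(1 / (V : ℝ))) (by linarith) s
  have h4 : (s : ℝ) / V = s * (1 / V) := by ring
  rw [h4]
  linarith

/-- A lower bound for the number of polynomials of degree at most `d`, from the monomials
`X₀ ^ a * X_{i + 1} ^ (b + 1)` with `a ≤ 2`. -/
theorem pow_le_card_polysDegLE {K : Type*} [Field K] [Fintype K] {r s d : ℕ}
    (hsr : s < r) (hd : 2 ≤ d) :
    Fintype.card K ^ (s * (3 * d - 3)) ≤ Nat.card (polysDegLE K r d) := by
  classical
  let U := Fin s × (Σ a : Fin 3, Fin (d - a))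
  let z : Fin r := ⟨0, by omega⟩
  let x : Fin s → Fin r := fun i => ⟨i + 1, by omega⟩
  have hxz : ∀ i, x i ≠ z := fun i h => by simp [x, z] at h
  let e : U → (Fin r →₀ ℕ) := fun u =>
    Finsupp.single z (u.2.1 : ℕ) + Finsupp.single (x u.1) ((u.2.2 : ℕ) + 1)
  have he : Function.Injective e := by
    rintro ⟨i, a, b⟩ ⟨i', a', b'⟩ h
    have hz := DFunLike.congr_fun h z
    have hx := DFunLike.congr_fun h (x i)
    simp only [e, Finsupp.add_apply, Finsupp.single_eq_same, Finsupp.single_apply,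
      if_neg (hxz i), if_neg (hxz i'), if_neg (hxz i).symm, add_zero, zero_add] at hz hx
    obtain rfl : a = a' := Fin.ext hz
    have hii : x i' = x i := by
      by_contra hne
      rw [if_neg hne] at hx
      simp at hx
    obtain rfl : i' = i := by
      simp only [x, Fin.mk.injEq, Nat.add_right_cancel_iff] at hii
      exact Fin.ext hii
    simp only [if_true, Nat.add_right_cancel_iff] at hx
    obtain rfl : b = b' := Fin.ext hx
    rfl
  -- For each of the `s` variables, `a = 0, 1, 2` allow `d + (d - 1) + (d - 2)` exponents.
  have hU : Fintype.card U = s * (3 * d - 3) := by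
    simp only [U, Fintype.card_prod, Fintype.card_sigma, Fintype.card_fin, Fin.sum_univ_three]
    congr 1
    simp
    omega
  let P : (U → K) → polysDegLE K r d := fun c =>
    ⟨∑ u, MvPolynomial.monomial (e u) (c u), by
      refine MvPolynomial.totalDegree_finsetSum_le fun u _ => ?_
      refine (MvPolynomial.totalDegree_monomial_le _ _).trans ?_
      have h1 := u.2.2.2
      have h2 := u.2.1.2
      rw [Finsupp.sum_add_index' (fun _ => rfl) (fun _ _ _ => rfl),
        Finsupp.sum_single_index rfl, Finsupp.sum_single_index rfl]
      simp only [id]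
      omega⟩
  have hP : Function.Injective P := by
    intro c c' h
    ext u
    have h1 : ∀ c : U → K, MvPolynomial.coeff (e u) (P c).1 = c u := by
      intro c
      rw [show (P c).1 = ∑ u, MvPolynomial.monomial (e u) (c u) from rfl,
        MvPolynomial.coeff_sum, Finset.sum_eq_single u, MvPolynomial.coeff_monomial, if_pos rfl]
      · intro v _ hv
        rw [MvPolynomial.coeff_monomial, if_neg (he.ne hv)]
      · exact fun h => absurd (Finset.mem_univ u) h
    rw [← h1 c, h, h1]
  have := Nat.card_le_card_of_injective P hP
  rwa [Nat.card_eq_fintype_card, Fintype.card_fun, hU] at this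

/-- Multiples of `s / #V` are bounded by `t_{d+1}`. -/
theorem div_card_polysDegLE_le {K : Type*} [Field K] [Fintype K] {r s d : ℕ} (c : ℕ)
    (hsr : s < r) (hd : 3 ≤ d) (hqd : d < Fintype.card K ^ s)
    (hc : c * s ≤ (Fintype.card K ^ s) ^ (2 * d - 4)) :
    (c : ℝ) * ((s : ℝ) / Nat.card (polysDegLE K r d)) ≤ tTerm (Fintype.card K) s (d + 1) := by
  set q := Fintype.card K with hq
  have hq0 : 0 < q := Fintype.card_pos
  have h1 : q ^ (s * (3 * d - 3)) ≤ Nat.card (polysDegLE K r d) :=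
    pow_le_card_polysDegLE hsr (by omega)
  have h2 : c * s * q ^ (s * (d + 1)) ≤ Nat.card (polysDegLE K r d) := by
    refine le_trans ?_ h1
    rw [show 3 * d - 3 = (2 * d - 4) + (d + 1) by omega, mul_add s (2 * d - 4), pow_add q (s * (2 * d - 4)),
      pow_mul q s (2 * d - 4)]
    exact Nat.mul_le_mul_right _ hc
  -- This is where `d < q ^ s` enters: it gives `t_{d+1} ≥ q^(-s(d+1))`.
  have h3 : 1 ≤ (q ^ s).choose (d + 1) := Nat.choose_pos (by omega)
  have hV : (0 : ℝ) < Nat.card (polysDegLE K r d) :=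
    Nat.cast_pos.2 (lt_of_lt_of_le (by positivity) h1)
  have hQ : (0 : ℝ) < (q : ℝ) ^ (s * (d + 1)) := by positivity
  have h2' : (c : ℝ) * s * (q : ℝ) ^ (s * (d + 1)) ≤ Nat.card (polysDegLE K r d) := by
    exact_mod_cast h2
  have h3' : (1 : ℝ) ≤ ((q ^ s).choose (d + 1) : ℕ) := by exact_mod_cast h3
  rw [tTerm, ← mul_div_assoc, div_le_div_iff₀ hV hQ]
  nlinarith

/-! ### Assembling the bounds -/

theorem mainTheorem7 {K : Type*} [Field K] [Fintype K] (q r s d h : ℕ)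
    (hq : Fintype.card K = q) (hs : 1 < s) (hsr : s < r) (hsd : s < d) (hqd : d < q ^ s)
    (hh : 1 < h) (hhr : h ≤ r - s + 1)
    (Fam : Set (MvPolynomial (Fin r) K))
    (hFam : Fam = polysDegLE K r d ∨ Fam = polysDegLE K r d \ {0}) :
    (Odd d →
      |probStripsNeeded Fam s h - sAlt q s d * (1 - sAlt q s d) ^ (h - 1)| ≤
        tTerm q s (d + 1) * ((1 + sPlus q s (d + 1)) ^ (h - 1) + 1 / 2) + 2 / (q : ℝ)) ∧
    (Even d →
      |probStripsNeeded Fam s h - sAlt q s (d + 1) * (1 - sAlt q s (d + 1)) ^ (h - 1)| ≤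
        tTerm q s (d + 1) * ((1 + sPlus q s (d + 1)) ^ (h - 1) + 1 / 2) + 2 / (q : ℝ)) := by
  subst hq
  set q := Fintype.card K with hq
  have hq2 : 2 ≤ q := Fintype.one_lt_card
  obtain ⟨n, rfl⟩ : ∃ n, h = n + 1 := ⟨h - 1, by omega⟩
  rw [Nat.add_sub_cancel]
  have hn : n ≤ r - s := by omega
  have hQ : 4 ≤ q ^ s := by omega
  have hsQ : s < q ^ s := Nat.lt_pow_self (by omega)
  have hmain := abs_probStripsNeeded_polysDegLE_sub_le (K := K) (r := r) (s := s) (d := d) (n := n)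
    (by omega) hsr.le hn hQ
  rw [← hq] at hmain
  have hmono : tTerm q s (d + 1) * (1 + sPlus q s d) ^ n ≤
      tTerm q s (d + 1) * (1 + sPlus q s (d + 1)) ^ n := by
    have := sPlus_nonneg q s d
    refine mul_le_mul_of_nonneg_left (pow_le_pow_left₀ (by linarith) ?_ _) (tTerm_nonneg _ _ _)
    rw [sPlus_succ]; linarith [tTerm_nonneg q s (d + 1)]
  have hzero : |probStripsNeeded Fam s (n + 1) - probStripsNeeded (polysDegLE K r d) s (n + 1)| ≤
      (s : ℝ) / Nat.card (polysDegLE K r d) := by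
    rcases hFam with rfl | rfl
    · rw [sub_self, abs_zero]; positivity
    · exact abs_probStripsNeeded_diff_zero_sub_le hn
  have hpow : ∀ k c : ℕ, k + 1 ≤ 2 * d - 4 → c ≤ 4 ^ k →
      c * s ≤ (q ^ s) ^ (2 * d - 4) := by
    intro k c hk hc
    calc c * s ≤ (q ^ s) ^ k * (q ^ s) :=
          Nat.mul_le_mul (hc.trans (Nat.pow_le_pow_left hQ k)) hsQ.le
      _ = (q ^ s) ^ (k + 1) := (pow_succ _ _).symm
      _ ≤ _ := Nat.pow_le_pow_right (by omega) hk
  have ht := tTerm_nonneg q s (d + 1)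
  constructor
  · intro _
    -- For odd `d` the whole `t_{d+1}/2` is available for excluding zero.
    have hε := div_card_polysDegLE_le (K := K) 2 hsr (by omega) hqd
      (hpow 1 2 (by omega) (by norm_num))
    rw [← hq] at hε
    push_cast at hε
    refine (abs_sub_le _ (probStripsNeeded (polysDegLE K r d) s (n + 1)) _).trans ?_
    linarith
  · intro hev
    have hd4 : 4 ≤ d := by
      obtain ⟨k, rfl⟩ := hev
      omega
    -- For even `d` the half splits as `7/16 + 1/16`: the Lipschitz bound for `s_d → s_{d+1}`, and
    -- the exclusion of zero.
    have hε := div_card_polysDegLE_le (K := K) 16 hsr (by omega) hqd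
      (hpow 2 16 (by omega) (by norm_num))
    rw [← hq] at hε
    push_cast at hε
    obtain ⟨a1, a2⟩ := sAlt_mem_Icc q s d (by omega) hQ (by omega)
    obtain ⟨b1, b2⟩ := sAlt_mem_Icc q s (d + 1) (by omega) hQ (by omega)
    have hlip := abs_mul_one_sub_pow_sub_le n (by omega) _ _ a1 a2 b1 b2
    have hdiff : |sAlt q s d - sAlt q s (d + 1)| = tTerm q s (d + 1) := by
      rw [sAlt_succ, hev.neg_one_pow, one_mul, sub_add_cancel_left, abs_neg, abs_of_nonneg ht]
    rw [hdiff] at hlip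
    refine (abs_sub_le _ (probStripsNeeded (polysDegLE K r d) s (n + 1)) _).trans ?_
    have := abs_sub_le (probStripsNeeded (polysDegLE K r d) s (n + 1))
      (sAlt q s d * (1 - sAlt q s d) ^ n) (sAlt q s (d + 1) * (1 - sAlt q s (d + 1)) ^ n)
    linarith
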